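/- Let $H$ be a complex Hilbert space and let $A:D(A)\subset H\to H$ be the infinitesimal generator of a $C_0$-semigroup of bounded linear operators on $H$. Suppose that $$ \sigma(A)\cap i\mathbb{R}=\emptyset\quad\text{and}\quad \sup_{\lambda\in i\mathbb{R}}\|(\lambda I-A)^{-1}\|<\infty . $$ Then the Cauchy problem $\dot u=Au$ has the L-shadowing property, i.e. $A$ is the infinitesimal generator of a $C_0$-semigroup $T=\{T(t)\}_{t\ge 0}$ with the following property. For every $\epsilon>0$ there are $\delta,R>0$ such that for every sequence $(x_i,t_i)_{i\ge 0}$ in $H\times(0,\infty)$ with $$ t_i\ge R\quad\text{and}\quad \|T(t_i)x_i-x_{i+1}\|<\delta\quad\text{for all } i\ge 0,\qquad \lim_{i\to\infty}\|T(t_i)x_i-x_{i+1}\|=0, $$ there are $x\in H$ and an increasing homeomorphism $h:[0,\infty)\to[0,\infty)$ such that $$ \|T(h(t))x-x_0*t\|<\epsilon\quad\text{for all } t\ge 0,\qquad \lim_{t\to\infty}\|T(t)x-x_0*t\|=0, $$ where $\hat t_i=\sum_{j=0}^{i-1}t_j$ (so $\hat t_0=0$) and $x_0*t=T(t-\hat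 t_i)x_i$ for $\hat t_i\le t<\hat t_{i+1}$, $i\ge0$. -/

import Mathlib

open Filter Topology
open scoped NNReal

/-- A semiflow of a metric space: continuous time-`t` maps `T(t)`, `t ≥ 0`, with `T(0) = I` and
`T(s + t) = T(s) ∘ T(t)`. -/
structure Semiflow (X : Type*) [MetricSpace X] where
  map : ℝ≥0 → X → X
  continuous_map : ∀ t, Continuous (map t)
  map_zero : ∀ x, map 0 x = x
  map_add : ∀ s t x, map (s + t) x = map s (map t x)

namespace Semiflow

variable {X : Type*} [MetricSpace X]

/-- The sequence `(x i, t i)` in `X × (0, ∞)` is a `(δ, R)`-pseudo orbit. -/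
def IsPseudoOrbit (T : Semiflow X) (δ R : ℝ) (x : ℕ → X) (t : ℕ → ℝ≥0) : Prop :=
  ∀ i, 0 < t i ∧ R ≤ (t i : ℝ) ∧ dist (T.map (t i) (x i)) (x (i + 1)) < δ

/-- The switching times `t̂ i = t 0 + ⋯ + t (i - 1)`. -/
def switchTime (t : ℕ → ℝ≥0) (i : ℕ) : ℝ≥0 := ∑ j ∈ Finset.range i, t j

/-- The number `i` with `t̂ i ≤ s < t̂ (i + 1)`, found as the largest `i` with `t̂ i ≤ s`. -/
noncomputable def switchIndex (t : ℕ → ℝ≥0) (s : ℝ≥0) : ℕ := sSup {i | switchTime t i ≤ s}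

/-- The broken orbit `x₀ * s = T(s - t̂ i) (x i)` for `t̂ i ≤ s < t̂ (i + 1)`. -/
noncomputable def brokenOrbit (T : Semiflow X) (x : ℕ → X) (t : ℕ → ℝ≥0) (s : ℝ≥0) : X :=
  T.map (s - switchTime t (switchIndex t s)) (x (switchIndex t s))

theorem switchTime_mono (t : ℕ → ℝ≥0) : Monotone (switchTime t) :=
  fun _ _ h => Finset.sum_le_sum_of_subset (Finset.range_mono h)

theorem switchIndex_eq {t : ℕ → ℝ≥0} {s : ℝ≥0} {i : ℕ} (h₁ : switchTime t i ≤ s)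
    (h₂ : s < switchTime t (i + 1)) : switchIndex t s = i := by
  have hg : IsGreatest {j | switchTime t j ≤ s} i := by
    refine ⟨h₁, fun j hj => ?_⟩
    by_contra hij
    exact absurd (h₂.trans_le (switchTime_mono t (by omega : i + 1 ≤ j))) (not_lt.mpr hj)
  exact hg.csSup_eq

theorem brokenOrbit_eq (T : Semiflow X) (x : ℕ → X) {t : ℕ → ℝ≥0} {s : ℝ≥0} {i : ℕ}
    (h₁ : switchTime t i ≤ s) (h₂ : s < switchTime t (i + 1)) :
    T.brokenOrbit x t s = T.map (s - switchTime t i) (x i) := by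
  rw [brokenOrbit, switchIndex_eq h₁ h₂]

/-- The L-shadowing property of a semiflow. -/
def LShadowing (T : Semiflow X) : Prop :=
  ∀ ε : ℝ, 0 < ε → ∃ δ R : ℝ, 0 < δ ∧ 0 < R ∧
    ∀ (x : ℕ → X) (t : ℕ → ℝ≥0), T.IsPseudoOrbit δ R x t →
      Tendsto (fun i => dist (T.map (t i) (x i)) (x (i + 1))) atTop (𝓝 0) →
      ∃ (y : X) (h : ℝ≥0 ≃ₜ ℝ≥0), StrictMono h ∧
        (∀ s, dist (T.map (h s) y) (T.brokenOrbit x t s) < ε) ∧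
        Tendsto (fun s => dist (T.map s y) (T.brokenOrbit x t s)) atTop (𝓝 0)

end Semiflow

/-- A `C₀`-semigroup of bounded linear operators of a complex normed space. -/
structure C0Semigroup (X : Type*) [NormedAddCommGroup X] [NormedSpace ℂ X] where
  op : ℝ≥0 → X →L[ℂ] X
  op_zero : op 0 = ContinuousLinearMap.id ℂ X
  op_add : ∀ s t, op (s + t) = (op s).comp (op t)
  tendsto_zero : ∀ x, Tendsto (fun t => ‖op t x - x‖) (𝓝 0) (𝓝 0)

namespace C0Semigroup

variable {X : Type*} [NormedAddCommGroup X] [NormedSpace ℂ X]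

/-- The semiflow given by a semigroup of operators. -/
def toSemiflow (T : C0Semigroup X) : Semiflow X where
  map t x := T.op t x
  continuous_map t := (T.op t).continuous
  map_zero x := by simp [T.op_zero]
  map_add s t x := by simp [T.op_add]

/-- The difference quotient `(T(t) x - x) / t`. -/
noncomputable def diffQuot (T : C0Semigroup X) (x : X) (t : ℝ≥0) : X :=
  ((t : ℝ) : ℂ)⁻¹ • (T.op t x - x)

theorem diffQuot_add (T : C0Semigroup X) (x y : X) (t : ℝ≥0) :
    T.diffQuot (x + y) t = T.diffQuot x t + T.diffQuot y t := by
  simp only [diffQuot, map_add, ← smul_add]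
  congr 1
  abel

theorem diffQuot_smul (T : C0Semigroup X) (c : ℂ) (x : X) (t : ℝ≥0) :
    T.diffQuot (c • x) t = c • T.diffQuot x t := by
  simp only [diffQuot, map_smul, ← smul_sub]
  rw [smul_comm]

/-- The domain `D(A)`: the vectors at which the difference quotient converges as `t ↓ 0`. -/
def generatorDomain (T : C0Semigroup X) : Submodule ℂ X where
  carrier := {x | ∃ y, Tendsto (T.diffQuot x) (𝓝[>] 0) (𝓝 y)}
  add_mem' := by
    rintro a b ⟨y, hy⟩ ⟨z, hz⟩
    exact ⟨y + z, (hy.add hz).congr fun t => (T.diffQuot_add a b t).symm⟩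
  zero_mem' := ⟨0, tendsto_const_nhds.congr fun t => by simp [diffQuot]⟩
  smul_mem' := by
    rintro c a ⟨y, hy⟩
    exact ⟨c • y, (hy.const_smul c).congr fun t => (T.diffQuot_smul c a t).symm⟩

/-- The infinitesimal generator `A x = lim_{t ↓ 0} (T(t) x - x) / t`, with domain `D(A)`. -/
noncomputable def generator (T : C0Semigroup X) : X →ₗ.[ℂ] X where
  domain := T.generatorDomain
  toFun :=
    { toFun := fun x => x.2.choose
      map_add' := fun x y => tendsto_nhds_unique (x + y).2.choose_spec
        ((x.2.choose_spec.add y.2.choose_spec).congr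
          fun t => (T.diffQuot_add x y t).symm)
      map_smul' := fun c x => tendsto_nhds_unique (c • x).2.choose_spec
        ((x.2.choose_spec.const_smul c).congr fun t => (T.diffQuot_smul c x t).symm) }

theorem mem_generator_domain (T : C0Semigroup X) (x : X) :
    x ∈ T.generator.domain ↔ ∃ y, Tendsto (T.diffQuot x) (𝓝[>] 0) (𝓝 y) := Iff.rfl

theorem tendsto_generator (T : C0Semigroup X) (x : T.generator.domain) :
    Tendsto (T.diffQuot x) (𝓝[>] 0) (𝓝 (T.generator x)) :=
  Exists.choose_spec x.2

end C0Semigroup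

section Unbounded

variable {X : Type*} [NormedAddCommGroup X] [NormedSpace ℂ X]

/-- `R` is a bounded two-sided inverse of `z I - A : D(A) → X`. -/
def IsResolventAt (A : X →ₗ.[ℂ] X) (z : ℂ) (R : X →L[ℂ] X) : Prop :=
  (∀ x : X, ∃ h : R x ∈ A.domain, z • R x - A ⟨R x, h⟩ = x) ∧
    ∀ x : A.domain, R (z • (x : X) - A x) = x

theorem IsResolventAt.unique {A : X →ₗ.[ℂ] X} {z : ℂ} {R S : X →L[ℂ] X}
    (hR : IsResolventAt A z R) (hS : IsResolventAt A z S) : R = S := by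
  ext x
  obtain ⟨h, hx⟩ := hS.1 x
  have := hR.2 ⟨S x, h⟩
  rwa [hx] at this

/-- The spectrum `σ(A)`: all `z` for which `z I - A` has no bounded inverse. -/
def operatorSpectrum (A : X →ₗ.[ℂ] X) : Set ℂ := {z | ¬ ∃ R, IsResolventAt A z R}

open Classical in
/-- The resolvent operator `(z I - A)⁻¹` for `z ∉ σ(A)` (and `0` for `z ∈ σ(A)`). -/
noncomputable def resolventOp (A : X →ₗ.[ℂ] X) (z : ℂ) : X →L[ℂ] X :=
  if h : ∃ R, IsResolventAt A z R then h.choose else 0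

theorem resolventOp_eq {A : X →ₗ.[ℂ] X} {z : ℂ} {R : X →L[ℂ] X} (hR : IsResolventAt A z R) :
    resolventOp A z = R := by
  have h : ∃ R, IsResolventAt A z R := ⟨R, hR⟩
  rw [resolventOp, dif_pos h]
  exact h.choose_spec.unique hR

/-- The imaginary axis `iℝ`. -/
def imaginaryAxis : Set ℂ := {z | z.re = 0}

/-- `A` is the infinitesimal generator of a `C₀`-semigroup. -/
def IsC0Generator (A : X →ₗ.[ℂ] X) : Prop := ∃ T : C0Semigroup X, T.generator = A

/-- The Cauchy problem `u' = A u` has the L-shadowing property: `A` is the infinitesimal generator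
of a `C₀`-semigroup with the L-shadowing property. -/
def CauchyLShadowing (A : X →ₗ.[ℂ] X) : Prop :=
  ∃ T : C0Semigroup X, T.generator = A ∧ T.toSemiflow.LShadowing

end Unbounded

/-! The proof has two halves. The spectral half is the Gearhart–Prüss argument: bounded resolvents
on `iℝ` force the unit circle into the resolvent set of `T(1)`. For `z ∈ iℝ`, the Fourier
coefficients on `[0,1]` of `s ↦ exp(-zs) T(s)x` are `R(z + 2πin) y`, where `y = x - exp(-z) T(1)x`.
Shifting `z` to the right by a large `ω` and applying Bessel shows that `∑ ‖R(z + 2πin) y‖²` is at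
most a multiple of `‖y‖²`. Parseval then bounds the orbit in `L²`, hence `T(1)x`, hence `x`, by
`‖y‖` (`exists_norm_le_norm_sub`). Dense range comes from uniqueness of Fourier coefficients
(`closure_range_one_sub`).

In the dynamical half, Laurent coefficients of the resolvent of `T(1)` split each vector into a
forward-decaying part and a part with a decaying backward orbit (`exists_discrete_dichotomy`,
`exists_hasDichotomy`). Split every jump of a pseudo orbit this way, push the stable parts forward
and pull the unstable parts back. The resulting series corrects the broken orbit to a true orbit,
with error at most a two-sided geometric average of the jump sizes. This average is small if the
jumps are small and tends to zero if they do (`HasDichotomy.lShadowing`). -/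

namespace C0Semigroup

/-! ### Semigroup bounds and Laplace integrals over the unit interval. -/

variable {X : Type*} [NormedAddCommGroup X] [NormedSpace ℂ X]

theorem op_add_apply (T : C0Semigroup X) (s t : ℝ≥0) (x : X) :
    T.op (s + t) x = T.op s (T.op t x) := by simp [T.op_add]

theorem tendsto_op_zero (T : C0Semigroup X) (x : X) :
    Tendsto (fun t => T.op t x) (𝓝 0) (𝓝 x) :=
  tendsto_iff_norm_sub_tendsto_zero.2 (T.tendsto_zero x)

theorem norm_op_nsmul_le (T : C0Semigroup X) {M : ℝ} (hM : 1 ≤ M) {s : ℝ≥0} (h : ‖T.op s‖ ≤ M)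
    (n : ℕ) : ‖T.op (n • s)‖ ≤ M ^ n := by
  induction n with
  | zero =>
    rw [zero_smul, T.op_zero, pow_zero]
    exact ContinuousLinearMap.norm_id_le
  | succ n ih =>
    rw [succ_nsmul, T.op_add, pow_succ]
    exact (ContinuousLinearMap.opNorm_comp_le _ _).trans
      (mul_le_mul ih h (norm_nonneg _) (by positivity))

/-- Otherwise there are times `t n → 0` with unbounded operator norms, although each `T(t n) x`
converges to `x`; this contradicts uniform boundedness. -/
theorem exists_norm_op_le_near_zero [CompleteSpace X] (T : C0Semigroup X) :
    ∃ (m : ℕ) (M : ℝ), ∀ t : ℝ≥0, t ≤ 1 / ((m : ℝ≥0) + 1) → ‖T.op t‖ ≤ M := by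
  by_contra! hcon
  choose t ht hM using fun n : ℕ => hcon n n
  have ht0 : Tendsto t atTop (𝓝 0) :=
    tendsto_of_tendsto_of_tendsto_of_le_of_le tendsto_const_nhds
      tendsto_one_div_add_atTop_nhds_zero_nat (fun _ => zero_le) ht
  obtain ⟨C, hC⟩ := banach_steinhaus (g := fun n => T.op (t n)) fun x => by
    have := ((T.tendsto_op_zero x).comp ht0).norm
    obtain ⟨C, hC⟩ := this.bddAbove_range
    exact ⟨C, fun n => hC ⟨n, rfl⟩⟩
  obtain ⟨n, hn⟩ := exists_nat_gt C
  exact absurd (hC n) (not_le.2 (hn.trans (hM n)))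

/-- The operators of a `C₀`-semigroup are bounded, uniformly on bounded time intervals. -/
theorem exists_norm_op_le [CompleteSpace X] (T : C0Semigroup X) (N : ℕ) :
    ∃ M : ℝ, 1 ≤ M ∧ ∀ t : ℝ≥0, t ≤ N → ‖T.op t‖ ≤ M := by
  obtain ⟨m, M, hM⟩ := T.exists_norm_op_le_near_zero
  refine ⟨(max M 1) ^ (N * (m + 1)), one_le_pow₀ (le_max_right _ _), fun t ht => ?_⟩
  rcases Nat.eq_zero_or_pos N with rfl | hN
  · have : t = 0 := le_antisymm (by simpa using ht) zero_le
    rw [this, T.op_zero]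
    simpa using ContinuousLinearMap.norm_id_le (𝕜 := ℂ) (E := X)
  have hk : (0 : ℝ≥0) < ((N * (m + 1) : ℕ) : ℝ≥0) := by positivity
  have h1 : t = (N * (m + 1)) • (t / ((N * (m + 1) : ℕ) : ℝ≥0)) := by
    rw [nsmul_eq_mul, mul_div_cancel₀ _ hk.ne']
  rw [h1]
  refine T.norm_op_nsmul_le (le_max_right _ _) ((hM _ ?_).trans (le_max_left _ _)) _
  rw [div_le_iff₀ hk]
  refine ht.trans (le_of_eq ?_)
  push_cast
  field_simp

/-- The orbits of a `C₀`-semigroup are continuous. -/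
theorem continuous_op_apply [CompleteSpace X] (T : C0Semigroup X) (x : X) :
    Continuous fun t => T.op t x := by
  rw [continuous_iff_continuousAt]
  intro t₀
  obtain ⟨N, hN⟩ := exists_nat_gt (t₀ + 1)
  obtain ⟨M, hM1, hM⟩ := T.exists_norm_op_le N
  -- Factoring out the operator at the smaller time handles left and right continuity alike.
  have key : ∀ s t : ℝ≥0, s ≤ t → s ≤ N →
      ‖T.op t x - T.op s x‖ ≤ M * ‖T.op (nndist t s) x - x‖ := by
    intro s t hst hs
    have h1 : nndist t s = t - s := by
      rw [NNReal.nndist_eq, tsub_eq_zero_of_le hst, max_eq_left zero_le]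
    have h2 : T.op t x = T.op s (T.op (nndist t s) x) := by
      rw [← op_add_apply, h1, add_tsub_cancel_of_le hst]
    rw [h2, ← map_sub]
    exact (T.op s).le_of_opNorm_le (hM s hs) _
  rw [ContinuousAt, tendsto_iff_norm_sub_tendsto_zero]
  have hlim : Tendsto (fun t => M * ‖T.op (nndist t t₀) x - x‖) (𝓝 t₀) (𝓝 0) := by
    have h1 : Tendsto (fun t => nndist t t₀) (𝓝 t₀) (𝓝 0) := by
      have : Continuous fun t : ℝ≥0 => nndist t t₀ := by fun_prop
      simpa using this.tendsto t₀
    simpa using ((T.tendsto_zero x).comp h1).const_mul M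
  refine tendsto_of_tendsto_of_tendsto_of_le_of_le' tendsto_const_nhds hlim
    (Eventually.of_forall fun _ => norm_nonneg _) ?_
  have hlt : t₀ < t₀ + 1 := by simp
  filter_upwards [Iio_mem_nhds hlt] with t ht
  rcases le_total t t₀ with h | h
  · rw [norm_sub_rev, nndist_comm]
    exact key t t₀ h ((le_of_lt ht).trans hN.le)
  · exact key t₀ t h (hlt.le.trans hN.le)

/-- The orbit of `x` multiplied by `exp (-z s)`, with the orbit frozen at `x` for negative times. -/
noncomputable def dampedOrbit (T : C0Semigroup X) (z : ℂ) (x : X) (s : ℝ) : X :=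
  Complex.exp (-(z * s)) • T.op s.toNNReal x

theorem continuous_dampedOrbit [CompleteSpace X] (T : C0Semigroup X) (z : ℂ) (x : X) :
    Continuous (T.dampedOrbit z x) := by
  have h := (T.continuous_op_apply x).comp continuous_real_toNNReal
  unfold dampedOrbit
  exact Continuous.smul (by fun_prop) h

/-- The integral of the damped orbit over the unit interval. -/
noncomputable def laplaceUnit (T : C0Semigroup X) (z : ℂ) (x : X) : X :=
  ∫ s in (0 : ℝ)..1, T.dampedOrbit z x s

/-- Translating the variable by `h` moves the integral to `[h, 1 + h]`. Written with base point `0`,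
the right side can be differentiated in `h`. -/
theorem op_laplaceUnit [CompleteSpace X] (T : C0Semigroup X) (z : ℂ) (x : X) (h : ℝ≥0) :
    T.op h (T.laplaceUnit z x) = Complex.exp (z * (h : ℝ)) •
      ((∫ s in (0 : ℝ)..(1 + h), T.dampedOrbit z x s) -
        ∫ s in (0 : ℝ)..h, T.dampedOrbit z x s) := by
  have hc := T.continuous_dampedOrbit z x
  rw [intervalIntegral.integral_interval_sub_left (hc.intervalIntegrable _ _)
    (hc.intervalIntegrable _ _), laplaceUnit,
    ← ContinuousLinearMap.intervalIntegral_comp_comm _ (hc.intervalIntegrable _ _),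
    ← intervalIntegral.integral_smul]
  have h1 := intervalIntegral.integral_comp_add_right (a := (0 : ℝ)) (b := 1)
    (fun s => Complex.exp (z * (h : ℝ)) • T.dampedOrbit z x s) (h : ℝ)
  rw [zero_add] at h1
  rw [← h1]
  refine intervalIntegral.integral_congr fun s hs => ?_
  rw [Set.uIcc_of_le zero_le_one] at hs
  simp only [dampedOrbit, map_smul, smul_smul, ← Complex.exp_add]
  have h2 : (s + (h : ℝ)).toNNReal = h + s.toNNReal := by
    rw [Real.toNNReal_add hs.1 h.coe_nonneg, Real.toNNReal_coe, add_comm]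
  rw [← op_add_apply, h2]
  congr 2
  push_cast
  ring

/-- The product rule at `h = 0` in `op_laplaceUnit`. It says `(z - A) F = x - exp(-z) T(1)x` for the
unit Laplace integral `F`. -/
theorem tendsto_diffQuot_laplaceUnit [CompleteSpace X] (T : C0Semigroup X) (z : ℂ) (x : X) :
    Tendsto (T.diffQuot (T.laplaceUnit z x)) (𝓝[>] 0)
      (𝓝 (z • T.laplaceUnit z x - (x - Complex.exp (-z) • T.op 1 x))) := by
  have hc := T.continuous_dampedOrbit z x
  have hd : ∀ b : ℝ, HasDerivAt (fun u => ∫ s in (0 : ℝ)..u, T.dampedOrbit z x s)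
      (T.dampedOrbit z x b) b := fun b =>
    intervalIntegral.integral_hasDerivAt_right (hc.intervalIntegrable _ _)
      hc.aestronglyMeasurable.stronglyMeasurableAtFilter hc.continuousAt
  have h1 : HasDerivAt (fun u : ℝ => ∫ s in (0 : ℝ)..(1 + u), T.dampedOrbit z x s)
      (T.dampedOrbit z x 1) 0 := by
    have := HasDerivAt.comp_const_add (1 : ℝ) (0 : ℝ) (by simpa using hd 1)
    simpa using this
  have he : HasDerivAt (fun u : ℝ => Complex.exp (z * u)) z 0 := by
    have h2 : HasDerivAt (fun u : ℝ => z * (u : ℂ)) z 0 := by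
      simpa using (Complex.ofRealCLM.hasDerivAt (x := (0 : ℝ))).const_mul z
    simpa using h2.cexp
  have htot := he.smul (h1.sub (hd 0))
  have hval : Complex.exp (z * ((0 : ℝ) : ℂ)) • (T.dampedOrbit z x 1 - T.dampedOrbit z x 0) +
      z • ((∫ s in (0 : ℝ)..(1 + 0), T.dampedOrbit z x s) -
        ∫ s in (0 : ℝ)..0, T.dampedOrbit z x s) =
      z • T.laplaceUnit z x - (x - Complex.exp (-z) • T.op 1 x) := by
    simp [dampedOrbit, laplaceUnit, T.op_zero]
    abel
  have hslope := htot.tendsto_slope_zero_right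
  rw [← hval]
  have hcoe : Tendsto (fun t : ℝ≥0 => (t : ℝ)) (𝓝[>] 0) (𝓝[>] 0) :=
    tendsto_nhdsWithin_iff.2 ⟨(NNReal.continuous_coe.tendsto' 0 0 rfl).mono_left
      nhdsWithin_le_nhds, by
        filter_upwards [self_mem_nhdsWithin] with t ht using NNReal.coe_pos.2 ht⟩
  refine (hslope.comp hcoe).congr fun t => ?_
  simp only [Function.comp_apply, zero_add, diffQuot, op_laplaceUnit, Pi.smul_apply', Pi.sub_apply]
  rw [← Complex.coe_smul, Complex.ofReal_inv]
  simp [laplaceUnit]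

theorem op_mem_domain (T : C0Semigroup X) (s : ℝ≥0) {x y : X}
    (h : Tendsto (T.diffQuot x) (𝓝[>] 0) (𝓝 y)) :
    Tendsto (T.diffQuot (T.op s x)) (𝓝[>] 0) (𝓝 (T.op s y)) := by
  refine (((T.op s).continuous.tendsto y).comp h).congr fun t => ?_
  simp only [Function.comp_apply, diffQuot, map_smul, map_sub, ← op_add_apply, add_comm]

end C0Semigroup

/-! ### Resolvent identities. -/

namespace IsResolventAt

variable {X : Type*} [NormedAddCommGroup X] [NormedSpace ℂ X] {T : C0Semigroup X}
  {z : ℂ} {R : X →L[ℂ] X}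

theorem apply_of_tendsto (hR : IsResolventAt T.generator z R) {x y : X}
    (h : Tendsto (T.diffQuot x) (𝓝[>] 0) (𝓝 y)) : R (z • x - y) = x := by
  have hx : x ∈ T.generator.domain := ⟨y, h⟩
  have h1 : T.generator ⟨x, hx⟩ = y := tendsto_nhds_unique (T.tendsto_generator ⟨x, hx⟩) h
  simpa [h1] using hR.2 ⟨x, hx⟩

theorem op_comm (hR : IsResolventAt T.generator z R) (s : ℝ≥0) (x : X) :
    R (T.op s x) = T.op s (R x) := by
  obtain ⟨h, hx⟩ := hR.1 x
  have h1 := hR.apply_of_tendsto (T.op_mem_domain s (T.tendsto_generator ⟨R x, h⟩))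
  rw [← map_smul, ← map_sub] at h1
  simpa only [hx] using h1

/-- The resolvent recovers the unit Laplace integral at the same point. -/
theorem apply_sub_eq_laplaceUnit [CompleteSpace X] (hR : IsResolventAt T.generator z R) (x : X) :
    R (x - Complex.exp (-z) • T.op 1 x) = T.laplaceUnit z x := by
  have h := hR.apply_of_tendsto (T.tendsto_diffQuot_laplaceUnit z x)
  rwa [sub_sub_cancel] at h

/-- The resolvent at `z` expressed through a unit Laplace integral at a shifted point. -/
theorem apply_eq_laplaceUnit_add [CompleteSpace X] (hR : IsResolventAt T.generator z R) (ω : ℂ)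
    (v : X) : R (v - Complex.exp (-(z + ω)) • T.op 1 v) =
      T.laplaceUnit (z + ω) v + ω • R (T.laplaceUnit (z + ω) v) := by
  have h := hR.apply_of_tendsto (T.tendsto_diffQuot_laplaceUnit (z + ω) v)
  set F := T.laplaceUnit (z + ω) v
  set w := v - Complex.exp (-(z + ω)) • T.op 1 v
  -- The bracket is `(z - A) F`, which the resolvent sends back to `F`.
  have hw : w = (z • F - ((z + ω) • F - w)) + ω • F := by module
  rw [hw, map_add, map_smul, h]

end IsResolventAt

/-! ### Bessel and Parseval estimates for Hilbert space valued functions. -/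

section VectorFourier

variable {E : Type*} [NormedAddCommGroup E] [NormedSpace ℂ E]

theorem fourierCoeffOn_unit_eq_integral (f : ℝ → E) (n : ℤ) :
    fourierCoeffOn (zero_lt_one' ℝ) f n =
      ∫ s in (0 : ℝ)..1, Complex.exp (-(2 * Real.pi * n * Complex.I * s)) • f s := by
  rw [fourierCoeffOn_eq_integral]
  simp only [sub_zero, div_one, one_smul]
  refine intervalIntegral.integral_congr fun s _ => ?_
  simp only [fourier_coe_apply]
  congr 2
  push_cast
  ring

theorem ContinuousLinearMap.fourierCoeffOn_unit_comp_comm {F : Type*} [NormedAddCommGroup F]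
    [NormedSpace ℂ F] [CompleteSpace E] [CompleteSpace F] (L : E →L[ℂ] F) {f : ℝ → E}
    (hf : Continuous f) (n : ℤ) :
    fourierCoeffOn (zero_lt_one' ℝ) (fun s => L (f s)) n =
      L (fourierCoeffOn (zero_lt_one' ℝ) f n) := by
  simp only [fourierCoeffOn_unit_eq_integral]
  rw [← ContinuousLinearMap.intervalIntegral_comp_comm]
  · simp
  · exact Continuous.intervalIntegrable (by fun_prop) _ _

end VectorFourier

section VectorParseval

theorem Continuous.hasSum_sq_fourierCoeffOn_unit {f : ℝ → ℂ} (hf : Continuous f) :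
    HasSum (fun n => ‖fourierCoeffOn (zero_lt_one' ℝ) f n‖ ^ 2) (∫ s in (0 : ℝ)..1, ‖f s‖ ^ 2) := by
  have hL2 : MeasureTheory.MemLp f 2 (MeasureTheory.volume.restrict (Set.Ioc 0 1)) := by
    obtain ⟨C, hC⟩ := isCompact_Icc.exists_bound_of_continuousOn
      (hf.continuousOn (s := Set.Icc (0 : ℝ) 1))
    refine MeasureTheory.MemLp.of_bound hf.aestronglyMeasurable C ?_
    filter_upwards [MeasureTheory.ae_restrict_mem measurableSet_Ioc] with s hs
    exact hC s ⟨hs.1.le, hs.2⟩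
  simpa using hasSum_sq_fourierCoeffOn (zero_lt_one' ℝ) hL2

variable {H : Type*} [NormedAddCommGroup H] [InnerProductSpace ℂ H] [CompleteSpace H]

/-- Parseval's identity for the projection of a vector valued function to a finite dimensional
subspace. -/
theorem Continuous.hasSum_sq_fourierCoeffOn_projection {f : ℝ → H} (hf : Continuous f)
    (V : Submodule ℂ H) [FiniteDimensional ℂ V] :
    HasSum (fun n => ‖V.starProjection (fourierCoeffOn (zero_lt_one' ℝ) f n)‖ ^ 2)
      (∫ s in (0 : ℝ)..1, ‖V.starProjection (f s)‖ ^ 2) := by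
  let b := stdOrthonormalBasis ℂ V
  let L : Fin (Module.finrank ℂ V) → H →L[ℂ] ℂ := fun i =>
    (innerSL ℂ (b i)).comp V.orthogonalProjectionOnto
  have hb : ∀ x : H, ‖V.starProjection x‖ ^ 2 = ∑ i, ‖L i x‖ ^ 2 := by
    intro x
    rw [Submodule.starProjection_apply, ← Submodule.coe_norm, ← b.sum_sq_norm_inner_right]
    rfl
  simp only [hb]
  rw [intervalIntegral.integral_finsetSum]
  · refine hasSum_sum fun i _ => ?_
    have h := Continuous.hasSum_sq_fourierCoeffOn_unit ((L i).continuous.comp hf)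
    simpa only [Function.comp_def, (L i).fourierCoeffOn_unit_comp_comm hf] using h
  · intro i _
    exact Continuous.intervalIntegrable (by fun_prop) _ _

/-- Bessel's inequality for vector valued functions on the unit interval. -/
theorem Continuous.sum_sq_fourierCoeffOn_le {f : ℝ → H} (hf : Continuous f) (F : Finset ℤ) :
    ∑ n ∈ F, ‖fourierCoeffOn (zero_lt_one' ℝ) f n‖ ^ 2 ≤ ∫ s in (0 : ℝ)..1, ‖f s‖ ^ 2 := by
  -- The projection to this span fixes the coefficients in question and does not increase `‖f s‖`,
  -- so finite dimensional Parseval suffices.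
  let V : Submodule ℂ H := Submodule.span ℂ (fourierCoeffOn (zero_lt_one' ℝ) f '' F)
  have : FiniteDimensional ℂ V := FiniteDimensional.span_of_finite ℂ (F.finite_toSet.image _)
  calc ∑ n ∈ F, ‖fourierCoeffOn (zero_lt_one' ℝ) f n‖ ^ 2
      = ∑ n ∈ F, ‖V.starProjection (fourierCoeffOn (zero_lt_one' ℝ) f n)‖ ^ 2 := by
        refine Finset.sum_congr rfl fun n hn => ?_
        rw [Submodule.starProjection_eq_self_iff.2
          (Submodule.subset_span (Set.mem_image_of_mem _ (Finset.mem_coe.2 hn)))]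
    _ ≤ ∫ s in (0 : ℝ)..1, ‖V.starProjection (f s)‖ ^ 2 :=
        sum_le_hasSum F (fun _ _ => sq_nonneg _) (hf.hasSum_sq_fourierCoeffOn_projection V)
    _ ≤ ∫ s in (0 : ℝ)..1, ‖f s‖ ^ 2 := by
        refine intervalIntegral.integral_mono_on zero_le_one
          (Continuous.intervalIntegrable (by fun_prop) _ _)
          (Continuous.intervalIntegrable (by fun_prop) _ _) fun s _ => ?_
        gcongr
        exact V.norm_starProjection_apply_le _

/-- The `L²` norm of a vector valued function is controlled by its Fourier coefficients. -/
theorem Continuous.integral_norm_sq_le_of_fourierCoeffOn {f : ℝ → H} (hf : Continuous f) {S : ℝ}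
    (hS : ∀ F : Finset ℤ, ∑ n ∈ F, ‖fourierCoeffOn (zero_lt_one' ℝ) f n‖ ^ 2 ≤ S) :
    ∫ s in (0 : ℝ)..1, ‖f s‖ ^ 2 ≤ S := by
  suffices h : ∀ ε : ℝ, 0 < ε → ∫ s in (0 : ℝ)..1, ‖f s‖ ^ 2 ≤ S + ε ^ 2 by
    have hlim : Tendsto (fun ε : ℝ => S + ε ^ 2) (𝓝[>] 0) (𝓝 S) := by
      have : Continuous fun ε : ℝ => S + ε ^ 2 := by fun_prop
      simpa using (this.tendsto 0).mono_left nhdsWithin_le_nhds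
    exact ge_of_tendsto hlim (by filter_upwards [self_mem_nhdsWithin] with ε hε using h ε hε)
  intro ε hε
  -- The curve `f([0,1])` is compact, so by Pythagoras projecting to the span of a finite `ε`-net
  -- loses at most `ε²` pointwise.
  obtain ⟨N, -, hNf, hN⟩ := finite_cover_balls_of_compact
    ((isCompact_Icc (a := (0 : ℝ)) (b := 1)).image hf) hε
  let V : Submodule ℂ H := Submodule.span ℂ N
  have : FiniteDimensional ℂ V := FiniteDimensional.span_of_finite ℂ hNf
  have hpt : ∀ s ∈ Set.Icc (0 : ℝ) 1, ‖f s‖ ^ 2 ≤ ‖V.starProjection (f s)‖ ^ 2 + ε ^ 2 := by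
    intro s hs
    obtain ⟨v, hv, hfv⟩ := Set.mem_iUnion₂.1 (hN ⟨s, hs, rfl⟩)
    have hvV : Vᗮ.starProjection v = 0 := by
      rw [Submodule.starProjection_orthogonal_val,
        Submodule.starProjection_eq_self_iff.2 (Submodule.subset_span hv), sub_self]
    have h1 : ‖Vᗮ.starProjection (f s)‖ ≤ ε := by
      rw [← sub_zero (Vᗮ.starProjection (f s)), ← hvV, ← map_sub]
      refine (Vᗮ.norm_starProjection_apply_le _).trans ?_
      rw [← dist_eq_norm]
      exact (Metric.mem_ball.1 hfv).le
    rw [V.norm_sq_eq_add_norm_sq_starProjection (f s)]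
    gcongr
  calc ∫ s in (0 : ℝ)..1, ‖f s‖ ^ 2
      ≤ ∫ s in (0 : ℝ)..1, (‖V.starProjection (f s)‖ ^ 2 + ε ^ 2) :=
        intervalIntegral.integral_mono_on zero_le_one
          (Continuous.intervalIntegrable (by fun_prop) _ _)
          (Continuous.intervalIntegrable (by fun_prop) _ _) hpt
    _ = (∫ s in (0 : ℝ)..1, ‖V.starProjection (f s)‖ ^ 2) + ε ^ 2 := by
        rw [intervalIntegral.integral_add (Continuous.intervalIntegrable (by fun_prop) _ _)
          (Continuous.intervalIntegrable (by fun_prop) _ _)]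
        simp
    _ ≤ S + ε ^ 2 := by
        gcongr
        refine hasSum_le_of_sum_le (hf.hasSum_sq_fourierCoeffOn_projection V) fun F =>
          (Finset.sum_le_sum fun n _ => ?_).trans (hS F)
        gcongr
        exact V.norm_starProjection_apply_le _

end VectorParseval

/-- The character `exp(-2πins)` merges with the damping factor. -/
theorem C0Semigroup.fourierCoeffOn_dampedOrbit {X : Type*} [NormedAddCommGroup X]
    [NormedSpace ℂ X] (T : C0Semigroup X) (z : ℂ) (x : X) (n : ℤ) :
    fourierCoeffOn (zero_lt_one' ℝ) (T.dampedOrbit z x) n =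
      T.laplaceUnit (z + 2 * Real.pi * n * Complex.I) x := by
  rw [fourierCoeffOn_unit_eq_integral, laplaceUnit]
  refine intervalIntegral.integral_congr fun s _ => ?_
  simp only [dampedOrbit, smul_smul, ← Complex.exp_add]
  congr 2
  ring

/-! ### From resolvent bounds on the imaginary axis to the spectrum of `T(1)`. -/

section Spectral

variable {H : Type*} [NormedAddCommGroup H] [InnerProductSpace ℂ H] [CompleteSpace H]

theorem Complex.exp_neg_add_two_pi_int_mul (z : ℂ) (n : ℤ) :
    Complex.exp (-(z + 2 * Real.pi * n * Complex.I)) = Complex.exp (-z) := by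
  rw [Complex.exp_eq_exp_iff_exists_int]
  exact ⟨-n, by push_cast; ring⟩

/-- Square summability of the resolvents along a vertical arithmetic progression. -/
theorem C0Semigroup.exists_sum_sq_resolvent_le (T : C0Semigroup H) {z : ℂ} (hz : z.re = 0)
    {R : ℤ → H →L[ℂ] H}
    (hR : ∀ n : ℤ, IsResolventAt T.generator (z + 2 * Real.pi * n * Complex.I) (R n)) {K : ℝ}
    (hK : ∀ n, ‖R n‖ ≤ K) :
    ∃ C : ℝ, 0 ≤ C ∧ ∀ y (F : Finset ℤ), ∑ n ∈ F, ‖R n y‖ ^ 2 ≤ (C * ‖y‖) ^ 2 := by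
  have hK0 : 0 ≤ K := (norm_nonneg _).trans (hK 0)
  obtain ⟨M, hM1, hM⟩ := T.exists_norm_op_le 1
  have hM0 : 0 < M := by linarith
  -- With this shift, `1 - exp(-(z + ω)) T(1)` is inverted by a Neumann series of norm at most `2`.
  obtain ⟨ω, hω0, hω⟩ : ∃ ω : ℝ, 0 ≤ ω ∧ Real.exp (-ω) * M ≤ 1 / 2 := by
    refine ⟨Real.log (2 * M), Real.log_nonneg (by linarith), ?_⟩
    rw [Real.exp_neg, Real.exp_log (by linarith)]
    field_simp
    rfl
  have hnexp : ∀ s : ℝ, ‖Complex.exp (-((z + ω) * s))‖ = Real.exp (-(ω * s)) := by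
    intro s
    rw [Complex.norm_exp]
    simp [hz]
  let a : H →L[ℂ] H := Complex.exp (-(z + ω)) • T.op 1
  have ha : ‖a‖ ≤ 1 / 2 := by
    have h1 := hnexp 1
    rw [Complex.ofReal_one, mul_one, mul_one] at h1
    rw [norm_smul, h1]
    refine le_trans ?_ hω
    gcongr
    exact hM 1 (by simp)
  obtain ⟨u, hu⟩ := isUnit_one_sub_of_norm_lt_one (lt_of_le_of_lt ha (by norm_num))
  -- The factor `1 + ω K` is the cost of shifting the resolvent; `2 M` bounds the damped orbit of
  -- `v` relative to `‖y‖`.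
  refine ⟨(1 + ω * K) * (2 * M), by positivity, fun y F => ?_⟩
  obtain ⟨v, hv⟩ : ∃ v, v - a v = y := by
    refine ⟨(↑u⁻¹ : H →L[ℂ] H) y, ?_⟩
    have h1 : (u * ↑u⁻¹ : H →L[ℂ] H) y = y := by rw [Units.mul_inv]; rfl
    rw [hu] at h1
    simpa using h1
  have hvy : ‖v‖ ≤ 2 * ‖y‖ := by
    have h1 : ‖v‖ ≤ ‖y‖ + ‖a v‖ := by
      rw [← hv]; simpa using norm_add_le (v - a v) (a v)
    have h2 := a.le_of_opNorm_le ha v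
    linarith
  have hbess := (T.continuous_dampedOrbit (z + ω) v).sum_sq_fourierCoeffOn_le F
  have hint : ∫ s in (0 : ℝ)..1, ‖T.dampedOrbit (z + ω) v s‖ ^ 2 ≤ (2 * M * ‖y‖) ^ 2 := by
    have h1 : ∀ s ∈ Set.Icc (0 : ℝ) 1,
        ‖T.dampedOrbit (z + ω) v s‖ ^ 2 ≤ (2 * M * ‖y‖) ^ 2 := by
      intro s hs
      have h2 : ‖T.op s.toNNReal v‖ ≤ M * ‖v‖ :=
        (T.op _).le_of_opNorm_le (hM _ (by simpa using hs.2)) v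
      have h3 : Real.exp (-(ω * s)) ≤ 1 :=
        Real.exp_le_one_iff.2 (by have := mul_nonneg hω0 hs.1; linarith)
      rw [C0Semigroup.dampedOrbit, norm_smul, hnexp]
      refine pow_le_pow_left₀ (by positivity) ?_ 2
      calc Real.exp (-(ω * s)) * ‖T.op s.toNNReal v‖ ≤ 1 * (M * ‖v‖) := by gcongr
        _ ≤ 1 * (M * (2 * ‖y‖)) := by gcongr
        _ = _ := by ring
    have hc := T.continuous_dampedOrbit (z + ω) v
    simpa using intervalIntegral.integral_mono_on (μ := MeasureTheory.volume) zero_le_one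
      (Continuous.intervalIntegrable (by fun_prop) _ _)
      (Continuous.intervalIntegrable (continuous_const (y := (2 * M * ‖y‖) ^ 2)) _ _) h1
  have hterm : ∀ n, ‖R n y‖ ≤
      (1 + ω * K) * ‖fourierCoeffOn (zero_lt_one' ℝ) (T.dampedOrbit (z + ω) v) n‖ := by
    intro n
    have h1 := (hR n).apply_eq_laplaceUnit_add ω v
    rw [add_right_comm, Complex.exp_neg_add_two_pi_int_mul] at h1
    rw [show v - Complex.exp (-(z + ω)) • T.op 1 v = y from hv] at h1
    rw [T.fourierCoeffOn_dampedOrbit, h1]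
    refine (norm_add_le _ _).trans ?_
    rw [norm_smul, Complex.norm_real, Real.norm_of_nonneg hω0, add_mul, one_mul, mul_assoc ω K]
    exact add_le_add_right (mul_le_mul_of_nonneg_left ((R n).le_of_opNorm_le (hK n) _) hω0) _
  calc ∑ n ∈ F, ‖R n y‖ ^ 2
      ≤ ∑ n ∈ F, (1 + ω * K) ^ 2 *
          ‖fourierCoeffOn (zero_lt_one' ℝ) (T.dampedOrbit (z + ω) v) n‖ ^ 2 := by
        refine Finset.sum_le_sum fun n _ => ?_
        rw [← mul_pow]
        gcongr
        exact hterm n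
    _ ≤ (1 + ω * K) ^ 2 * (2 * M * ‖y‖) ^ 2 := by
        rw [← Finset.mul_sum]
        gcongr
        exact hbess.trans hint
    _ = _ := by ring

/-- If the resolvents along `z + 2πiℤ` exist and are bounded, then `1 - exp (-z) T(1)` is bounded
below. -/
theorem C0Semigroup.exists_norm_le_norm_sub (T : C0Semigroup H) {z : ℂ} (hz : z.re = 0)
    {R : ℤ → H →L[ℂ] H}
    (hR : ∀ n : ℤ, IsResolventAt T.generator (z + 2 * Real.pi * n * Complex.I) (R n)) {K : ℝ}
    (hK : ∀ n, ‖R n‖ ≤ K) :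
    ∃ C : ℝ, 0 ≤ C ∧ ∀ x, ‖x‖ ≤ C * ‖x - Complex.exp (-z) • T.op 1 x‖ := by
  obtain ⟨C, hC0, hC⟩ := T.exists_sum_sq_resolvent_le hz hR hK
  obtain ⟨M, hM1, hM⟩ := T.exists_norm_op_le 1
  have hM0 : 0 < M := by linarith
  have hnexp : ∀ s : ℝ, ‖Complex.exp (-(z * s))‖ = 1 := by
    intro s
    rw [Complex.norm_exp]
    simp [hz]
  refine ⟨1 + M * C, by positivity, fun x => ?_⟩
  set y := x - Complex.exp (-z) • T.op 1 x with hy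
  have hc := T.continuous_dampedOrbit z x
  -- The Fourier coefficients of this orbit are exactly the vectors `R n y`.
  have hint : ∫ s in (0 : ℝ)..1, ‖T.dampedOrbit z x s‖ ^ 2 ≤ (C * ‖y‖) ^ 2 := by
    refine hc.integral_norm_sq_le_of_fourierCoeffOn fun F => ?_
    refine le_trans (le_of_eq (Finset.sum_congr rfl fun n _ => ?_)) (hC y F)
    rw [T.fourierCoeffOn_dampedOrbit, ← (hR n).apply_sub_eq_laplaceUnit,
      Complex.exp_neg_add_two_pi_int_mul]
  -- Every `T(s)x` with `s ≤ 1` is carried to `T(1)x` by an operator of norm at most `M`, and the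
  -- damping has modulus one.
  have hlow : ‖T.op 1 x‖ ^ 2 ≤ ∫ s in (0 : ℝ)..1, M ^ 2 * ‖T.dampedOrbit z x s‖ ^ 2 := by
    have h1 : ∀ s ∈ Set.Icc (0 : ℝ) 1, ‖T.op 1 x‖ ^ 2 ≤ M ^ 2 * ‖T.dampedOrbit z x s‖ ^ 2 := by
      intro s hs
      have hs1 : s.toNNReal ≤ 1 := by simpa using hs.2
      have h2 : T.op 1 x = T.op (1 - s.toNNReal) (T.op s.toNNReal x) := by
        rw [← T.op_add_apply, tsub_add_cancel_of_le hs1]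
      rw [C0Semigroup.dampedOrbit, norm_smul, hnexp, one_mul, ← mul_pow, h2]
      gcongr
      exact (T.op _).le_of_opNorm_le (hM _ (by simp)) _
    simpa using intervalIntegral.integral_mono_on (μ := MeasureTheory.volume) zero_le_one
      (Continuous.intervalIntegrable (continuous_const (y := ‖T.op 1 x‖ ^ 2)) _ _)
      (Continuous.intervalIntegrable (by fun_prop) _ _) h1
  have hT : ‖T.op 1 x‖ ≤ M * C * ‖y‖ := by
    refine (sq_le_sq₀ (norm_nonneg _) (by positivity)).1 ?_
    rw [intervalIntegral.integral_const_mul] at hlow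
    refine hlow.trans ?_
    rw [mul_assoc, mul_pow]
    gcongr
  have h1 : ‖x‖ ≤ ‖y‖ + ‖Complex.exp (-z) • T.op 1 x‖ := by
    rw [hy]; simpa using norm_add_le (x - Complex.exp (-z) • T.op 1 x) (Complex.exp (-z) • T.op 1 x)
  have h2 := hnexp 1
  rw [Complex.ofReal_one, mul_one] at h2
  rw [norm_smul, h2, one_mul] at h1
  linarith

/-- A continuous function on the unit interval with vanishing Fourier coefficients vanishes at
the origin. -/
theorem Continuous.eq_zero_of_fourierCoeffOn_eq_zero {f : ℝ → ℂ} (hf : Continuous f)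
    (h : ∀ n, fourierCoeffOn (zero_lt_one' ℝ) f n = 0) : f 0 = 0 := by
  have h0 : ∫ s in (0 : ℝ)..1, ‖f s‖ ^ 2 = 0 := by
    refine hf.hasSum_sq_fourierCoeffOn_unit.unique ?_
    simp [h]
  by_contra hne
  refine absurd h0 (ne_of_gt ?_)
  exact intervalIntegral.integral_pos zero_lt_one (by fun_prop) (fun _ _ => sq_nonneg _)
    ⟨0, by simp, by positivity⟩

/-- Let `w` be orthogonal to the range. The function `s ↦ ⟨w, exp(-zs) T(s)w⟩` has as Fourier
coefficients the products of `w` with `R n (w - exp(-z) T(1)w)`. Since `R n` commutes with `T(1)`,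
these vectors lie in the range, so all coefficients vanish, and so does the value `‖w‖²` at `s = 0`.
-/
theorem C0Semigroup.closure_range_one_sub (T : C0Semigroup H) {z : ℂ} {R : ℤ → H →L[ℂ] H}
    (hR : ∀ n : ℤ, IsResolventAt T.generator (z + 2 * Real.pi * n * Complex.I) (R n)) :
    (1 - Complex.exp (-z) • T.op 1 : H →L[ℂ] H).range.topologicalClosure = ⊤ := by
  rw [Submodule.topologicalClosure_eq_top_iff, Submodule.eq_bot_iff]
  intro w hw
  rw [Submodule.mem_orthogonal'] at hw
  have hw' : ∀ x, inner ℂ w (x - Complex.exp (-z) • T.op 1 x) = 0 := fun x => hw _ ⟨x, rfl⟩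
  have hc := T.continuous_dampedOrbit z w
  have hcoef : ∀ n, fourierCoeffOn (zero_lt_one' ℝ)
      (fun s => innerSL ℂ w (T.dampedOrbit z w s)) n = 0 := by
    intro n
    rw [(innerSL ℂ w).fourierCoeffOn_unit_comp_comm hc, T.fourierCoeffOn_dampedOrbit,
      ← (hR n).apply_sub_eq_laplaceUnit, Complex.exp_neg_add_two_pi_int_mul, map_sub, map_smul,
      (hR n).op_comm]
    exact hw' _
  have h0 := Continuous.eq_zero_of_fourierCoeffOn_eq_zero (by fun_prop) hcoef
  simpa [C0Semigroup.dampedOrbit, T.op_zero] using h0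

/-- If the resolvents along `z + 2πiℤ` exist and are bounded, then `exp z` is in the resolvent set
of `T(1)`. -/
theorem C0Semigroup.exp_mem_resolventSet (T : C0Semigroup H) {z : ℂ} (hz : z.re = 0)
    {R : ℤ → H →L[ℂ] H}
    (hR : ∀ n : ℤ, IsResolventAt T.generator (z + 2 * Real.pi * n * Complex.I) (R n)) {K : ℝ}
    (hK : ∀ n, ‖R n‖ ≤ K) : Complex.exp z ∈ resolventSet ℂ (T.op 1) := by
  obtain ⟨C, hC0, hC⟩ := T.exists_norm_le_norm_sub hz hR hK
  have hu : IsUnit (1 - Complex.exp (-z) • T.op 1 : H →L[ℂ] H) := by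
    rw [ContinuousLinearMap.isUnit_iff_bijective,
      ContinuousLinearMap.bijective_iff_dense_range_and_antilipschitz]
    refine ⟨T.closure_range_one_sub hR, ⟨C, hC0⟩, ?_⟩
    exact ContinuousLinearMap.antilipschitz_of_bound _ fun x => hC x
  rw [spectrum.mem_resolventSet_iff]
  have h1 : (algebraMap ℂ (H →L[ℂ] H)) (Complex.exp z) - T.op 1 =
      algebraMap ℂ (H →L[ℂ] H) (Complex.exp z) * (1 - Complex.exp (-z) • T.op 1) := by
    rw [Algebra.algebraMap_eq_smul_one, smul_mul_assoc, one_mul, smul_sub, smul_smul,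
      ← Complex.exp_add, add_neg_cancel, Complex.exp_zero, one_smul]
  rw [h1]
  exact ((isUnit_iff_ne_zero.2 (Complex.exp_ne_zero z)).map _).mul hu

end Spectral

/-! ### Dichotomy for one operator whose spectrum avoids the unit circle. -/

section DiscreteDichotomy

variable {E : Type*} [NormedAddCommGroup E] [NormedSpace ℂ E] [CompleteSpace E]

theorem ContinuousLinearMap.circleIntegral_comp_comm {F : Type*} [NormedAddCommGroup F]
    [NormedSpace ℂ F] [CompleteSpace F] (L : E →L[ℂ] F) {f : ℂ → E} {c : ℂ} {R : ℝ}
    (hf : CircleIntegrable f c R) : (∮ z in C(c, R), L (f z)) = L (∮ z in C(c, R), f z) := by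
  rw [circleIntegral, circleIntegral, ← L.intervalIntegral_comp_comm hf.out]
  simp

/-- A closed annulus around the unit circle avoids the spectrum, if the circle does. -/
theorem exists_annulus_subset_resolventSet {B : E →L[ℂ] E}
    (hB : Metric.sphere (0 : ℂ) 1 ⊆ resolventSet ℂ B) :
    ∃ r : ℝ, 0 < r ∧ r < 1 ∧ ∀ z : ℂ, r ≤ ‖z‖ → ‖z‖ ≤ r⁻¹ → z ∈ resolventSet ℂ B := by
  have hclosed : IsClosed (norm '' spectrum ℂ B) :=
    ((spectrum.isCompact B).image continuous_norm).isClosed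
  have h1 : (1 : ℝ) ∈ (norm '' spectrum ℂ B)ᶜ := by
    rintro ⟨z, hz, hz1⟩
    exact hz (hB (by simpa using hz1))
  obtain ⟨ε, hε, hball⟩ := Metric.isOpen_iff.1 hclosed.isOpen_compl 1 h1
  have hpos : 0 < 1 + ε / 2 := by linarith
  have hr1 : (1 + ε / 2)⁻¹ < 1 := inv_lt_one_of_one_lt₀ (by linarith)
  refine ⟨(1 + ε / 2)⁻¹, by positivity, hr1, fun z hz1 hz2 => ?_⟩
  rw [inv_inv] at hz2
  by_contra hz
  refine hball (?_ : ‖z‖ ∈ Metric.ball (1 : ℝ) ε) ⟨z, hz, rfl⟩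
  have h2 : 1 - ε < (1 + ε / 2)⁻¹ := by
    have h3 : (1 + ε / 2) * (1 + ε / 2)⁻¹ = 1 := mul_inv_cancel₀ hpos.ne'
    nlinarith
  rw [Metric.mem_ball, Real.dist_eq, abs_lt]
  constructor <;> linarith

/-- The Laurent coefficients of the resolvent on the unit circle, applied to a vector. -/
noncomputable def resolventCoeff (B : E →L[ℂ] E) (d : E) (k : ℤ) : E :=
  (2 * Real.pi * Complex.I : ℂ)⁻¹ • ∮ z in C(0, 1), z ^ k • resolvent B z d

theorem continuousOn_zpow_smul_resolvent {B : E →L[ℂ] E} {s : Set ℂ}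
    (hs : s ⊆ resolventSet ℂ B) (hs0 : (0 : ℂ) ∉ s) (d : E) (k : ℤ) :
    ContinuousOn (fun z : ℂ => z ^ k • resolvent B z d) s := by
  intro z hz
  have h0 : z ≠ 0 := fun h => hs0 (h ▸ hz)
  have h1 := (spectrum.hasDerivAt_resolvent_const_left (hs hz)).continuousAt
  exact ((continuousAt_zpow₀ z k (Or.inl h0)).smul (h1.clm_apply continuousAt_const)).continuousWithinAt

/-- Integrate `B (z - B)⁻¹ = z (z - B)⁻¹ - 1` against `z ^ k`; only `k = -1` has a residue. The
coefficients thus form a two-sided orbit of `B` with one jump `d`. -/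
theorem op_resolventCoeff {B : E →L[ℂ] E} (hB : Metric.sphere (0 : ℂ) 1 ⊆ resolventSet ℂ B)
    (d : E) (k : ℤ) :
    B (resolventCoeff B d k) = resolventCoeff B d (k + 1) - if k = -1 then d else 0 := by
  have hs0 : (0 : ℂ) ∉ Metric.sphere (0 : ℂ) 1 := by simp
  have hint : ∀ j : ℤ, CircleIntegrable (fun z : ℂ => z ^ j • resolvent B z d) 0 1 := fun j =>
    (continuousOn_zpow_smul_resolvent hB hs0 d j).circleIntegrable zero_le_one
  have hintd : CircleIntegrable (fun z : ℂ => z ^ k • d) 0 1 := by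
    refine ContinuousOn.circleIntegrable zero_le_one fun z hz => ?_
    have h0 : z ≠ 0 := fun h => hs0 (h ▸ hz)
    exact ((continuousAt_zpow₀ z k (Or.inl h0)).smul continuousAt_const).continuousWithinAt
  have hz : ∀ z ∈ Metric.sphere (0 : ℂ) 1,
      B (z ^ k • resolvent B z d) = z ^ (k + 1) • resolvent B z d - z ^ k • d := by
    intro z hz
    have h0 : z ≠ 0 := fun h => hs0 (h ▸ hz)
    have hu : IsUnit (algebraMap ℂ (E →L[ℂ] E) z - B) := hB hz
    have h1 : (algebraMap ℂ (E →L[ℂ] E) z - B) (resolvent B z d) = d := by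
      rw [← mul_apply_eq_comp, resolvent, Ring.mul_inverse_cancel _ hu,
        one_apply_eq_self]
    have h2 : B (resolvent B z d) = z • resolvent B z d - d := by
      rw [sub_apply, Algebra.algebraMap_eq_smul_one] at h1
      simp only [smul_apply, one_apply_eq_self] at h1
      nth_rewrite 3 [← h1]
      abel
    rw [map_smul, h2, smul_sub, smul_smul, zpow_add_one₀ h0]
  rw [resolventCoeff, map_smul, ← B.circleIntegral_comp_comm (hint k),
    circleIntegral.integral_congr zero_le_one hz, circleIntegral.integral_sub (hint _) hintd,
    circleIntegral.integral_smul_const, smul_sub, resolventCoeff]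
  congr 1
  split_ifs with hk
  · have h1 := circleIntegral.integral_sub_center_inv (0 : ℂ) (one_ne_zero (α := ℝ))
    simp only [sub_zero] at h1
    simp only [hk, zpow_neg_one, h1]
    exact inv_smul_smul₀ Complex.two_pi_I_ne_zero d
  · have h1 := circleIntegral.integral_sub_zpow_of_ne hk 0 0 1
    simp only [sub_zero] at h1
    rw [h1, zero_smul, smul_zero]

/-- By Cauchy the contour can be moved: radius `r` gives decay as `k → ∞`, radius `r⁻¹` decay as `k
→ -∞`. -/
theorem resolventCoeff_eq_of_annulus {B : E →L[ℂ] E} {r : ℝ} (hr0 : 0 < r) (hr1 : r < 1)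
    (hB : ∀ z : ℂ, r ≤ ‖z‖ → ‖z‖ ≤ r⁻¹ → z ∈ resolventSet ℂ B) {ρ : ℝ} (h1 : r ≤ ρ)
    (h2 : ρ ≤ r⁻¹) (d : E) (k : ℤ) :
    resolventCoeff B d k =
      (2 * Real.pi * Complex.I : ℂ)⁻¹ • ∮ z in C(0, ρ), z ^ k • resolvent B z d := by
  have key : ∀ a b : ℝ, r ≤ a → a ≤ b → b ≤ r⁻¹ →
      (∮ z in C(0, b), z ^ k • resolvent B z d) = ∮ z in C(0, a), z ^ k • resolvent B z d := by
    intro a b ha hab hb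
    have ha0 : 0 < a := hr0.trans_le ha
    refine Complex.circleIntegral_eq_of_differentiable_on_annulus_off_countable ha0 hab
      Set.countable_empty (continuousOn_zpow_smul_resolvent (fun z hz => ?_) ?_ d k)
      fun z hz => ?_
    · simp only [Set.mem_sdiff, Metric.mem_closedBall, dist_zero_right, Metric.mem_ball,
        not_lt] at hz
      exact hB z (ha.trans hz.2) (hz.1.trans hb)
    · simpa using fun _ => ha0
    · simp only [Set.mem_sdiff, Metric.mem_closedBall, dist_zero_right, Metric.mem_ball,
        not_le, Set.mem_empty_iff_false, not_false_eq_true, and_true] at hz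
      have h0 : z ≠ 0 := norm_pos_iff.1 (ha0.trans hz.2)
      have hd := (spectrum.hasDerivAt_resolvent_const_left
        (hB z (ha.trans hz.2.le) (hz.1.le.trans hb))).differentiableAt
      exact (differentiableAt_zpow.2 (Or.inl h0)).smul
        (hd.clm_apply (differentiableAt_const d))
  rw [resolventCoeff]
  congr 1
  rcases le_total ρ 1 with h | h
  · exact key ρ 1 h1 h ((one_le_inv₀ hr0).2 hr1.le)
  · exact (key 1 ρ hr1.le h h2).symm

/-- If the spectrum of `B` avoids the unit circle, then every vector splits into a vector with
exponentially decaying forward orbit and one with an exponentially decaying backward orbit. -/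
theorem exists_discrete_dichotomy {B : E →L[ℂ] E}
    (hB : Metric.sphere (0 : ℂ) 1 ⊆ resolventSet ℂ B) :
    ∃ r C : ℝ, 0 < r ∧ r < 1 ∧ 0 ≤ C ∧ ∀ d : E, ∃ (p : E) (q : ℕ → E), p + q 0 = d ∧
      (∀ n, B (q (n + 1)) = q n) ∧ (∀ n : ℕ, ‖(B ^ n) p‖ ≤ C * r ^ n * ‖d‖) ∧
      ∀ n, ‖q n‖ ≤ C * r ^ n * ‖d‖ := by
  obtain ⟨r, hr0, hr1, hr⟩ := exists_annulus_subset_resolventSet hB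
  have hrinv : 1 < r⁻¹ := (one_lt_inv₀ hr0).2 hr1
  obtain ⟨K, hK⟩ : ∃ K : ℝ, ∀ z : ℂ, r ≤ ‖z‖ → ‖z‖ ≤ r⁻¹ → ‖resolvent B z‖ ≤ K := by
    have hcpt : IsCompact (Metric.closedBall (0 : ℂ) r⁻¹ \ Metric.ball 0 r) :=
      (isCompact_closedBall _ _).diff Metric.isOpen_ball
    obtain ⟨K, hK⟩ := hcpt.exists_bound_of_continuousOn (f := resolvent B) fun z hz => by
      simp only [Set.mem_sdiff, Metric.mem_closedBall, dist_zero_right, Metric.mem_ball,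
        not_lt] at hz
      exact (spectrum.hasDerivAt_resolvent_const_left
        (hr z hz.2 hz.1)).continuousAt.continuousWithinAt
    exact ⟨K, fun z h1 h2 => hK z (by simp [h1, h2])⟩
  have hK0 : 0 ≤ K := (norm_nonneg _).trans (hK 1 (by simpa using hr1.le) (by simpa using hrinv.le))
  have hbound : ∀ ρ : ℝ, r ≤ ρ → ρ ≤ r⁻¹ → ∀ (d : E) (k : ℤ),
      ‖resolventCoeff B d k‖ ≤ ρ * (ρ ^ k * (K * ‖d‖)) := by
    intro ρ h1 h2 d k
    rw [resolventCoeff_eq_of_annulus hr0 hr1 hr h1 h2]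
    refine circleIntegral.norm_two_pi_i_inv_smul_integral_le_of_norm_le_const
      (hr0.le.trans h1) fun z hz => ?_
    have hz' : ‖z‖ = ρ := by simpa using hz
    rw [norm_smul, norm_zpow, hz']
    have : 0 ≤ ρ := hr0.le.trans h1
    gcongr
    exact (resolvent B z).le_of_opNorm_le (hK z (hz' ▸ h1) (hz' ▸ h2)) d
  refine ⟨r, 1 + K * r⁻¹, hr0, hr1, by positivity, fun d => ?_⟩
  have hpow : ∀ n : ℕ, (B ^ n) (resolventCoeff B d 0) = resolventCoeff B d n := by
    intro n
    induction n with
    | zero => simp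
    | succ n ih =>
      rw [pow_succ', mul_apply_eq_comp, ih, op_resolventCoeff hB, if_neg (by omega)]
      simp
  have hback : ∀ n : ℕ, ‖resolventCoeff B d (-(n : ℤ))‖ ≤ K * r⁻¹ * r ^ n * ‖d‖ := by
    intro n
    refine (hbound r⁻¹ (hr1.le.trans hrinv.le) le_rfl d _).trans (le_of_eq ?_)
    rw [zpow_neg, inv_zpow, inv_inv, zpow_natCast]
    ring
  -- The stable part is the Riesz projection of `d`. The summand `d` at `n = 0` compensates for the
  -- jump of the coefficients at `k = -1`.
  refine ⟨resolventCoeff B d 0,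
    fun n => (if n = 0 then d else 0) - resolventCoeff B d (-(n : ℤ)), by simp, ?_, ?_, ?_⟩
  · intro n
    simp only [Nat.add_eq_zero_iff, one_ne_zero, and_false, if_false, zero_sub, map_neg,
      op_resolventCoeff hB]
    have h1 : -((n + 1 : ℕ) : ℤ) + 1 = -(n : ℤ) := by push_cast; ring
    have h2 : -((n + 1 : ℕ) : ℤ) = -1 ↔ n = 0 := by omega
    simp only [h1, h2, neg_sub]
  · intro n
    rw [hpow]
    refine (hbound r le_rfl (hr1.le.trans hrinv.le) d n).trans ?_
    rw [zpow_natCast]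
    have h1 : r * K ≤ 1 + K * r⁻¹ := by
      have := mul_le_mul_of_nonneg_left (hr1.le.trans hrinv.le) hK0
      linarith
    calc r * (r ^ n * (K * ‖d‖)) = (r * K) * r ^ n * ‖d‖ := by ring
      _ ≤ _ := by gcongr
  · intro n
    refine (norm_sub_le _ _).trans ?_
    have h1 : ‖(if n = 0 then d else 0 : E)‖ ≤ r ^ n * ‖d‖ := by
      split_ifs with h
      · simp [h]
      · rw [norm_zero]; positivity
    have h2 := hback n
    linarith

end DiscreteDichotomy

/-! ### Dichotomy in continuous time. -/

namespace C0Semigroup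

variable {X : Type*} [NormedAddCommGroup X] [NormedSpace ℂ X]

theorem op_natCast (T : C0Semigroup X) (n : ℕ) : T.op n = T.op 1 ^ n := by
  induction n with
  | zero => rw [Nat.cast_zero, pow_zero, T.op_zero]; rfl
  | succ n ih => rw [Nat.cast_succ, T.op_add, ih, pow_succ]; rfl

/-- An exponential dichotomy with rate `r` and constant `C`, stated for single vectors: every `d`
is the sum of a vector with a decaying forward orbit and one with a decaying backward orbit. -/
def HasDichotomy (T : C0Semigroup X) (r C : ℝ) : Prop :=
  ∀ d : X, ∃ (p : X) (q : ℝ≥0 → X), p + q 0 = d ∧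
    (∀ a s, T.op a (q (s + a)) = q s) ∧
    (∀ (n : ℕ) (s : ℝ≥0), n ≤ s → ‖T.op s p‖ ≤ C * (r ^ n * ‖d‖)) ∧
    ∀ (n : ℕ) (s : ℝ≥0), n ≤ s → ‖q s‖ ≤ C * (r ^ n * ‖d‖)

/-- Interpolates the discrete orbits: `T(s)p` starts from time `⌊s⌋₊`, `q s` flows down from `⌈s⌉₊`.
The remaining time is at most one and costs a factor `M`. -/
theorem exists_hasDichotomy [CompleteSpace X] (T : C0Semigroup X)
    (hT : Metric.sphere (0 : ℂ) 1 ⊆ resolventSet ℂ (T.op 1)) :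
    ∃ r C : ℝ, 0 < r ∧ r < 1 ∧ 0 ≤ C ∧ T.HasDichotomy r C := by
  obtain ⟨r, C, hr0, hr1, hC, h⟩ := exists_discrete_dichotomy hT
  obtain ⟨M, hM1, hM⟩ := T.exists_norm_op_le 1
  have hM0 : 0 ≤ M := by linarith
  refine ⟨r, M * C, hr0, hr1, by positivity, fun d => ?_⟩
  obtain ⟨p, q, hpq, hq, hp, hqn⟩ := h d
  -- Any later integer may replace the ceiling, which gives the backward orbit law.
  have hfrom : ∀ s : ℝ≥0, ∀ m : ℕ, ⌈s⌉₊ ≤ m →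
      T.op (m - s) (q m) = T.op (⌈s⌉₊ - s) (q ⌈s⌉₊) := by
    intro s m hm
    induction m, hm using Nat.le_induction with
    | base => rfl
    | succ m hm ih =>
      have hs : s ≤ m := Nat.ceil_le.1 hm
      have h1 : ((m + 1 : ℕ) : ℝ≥0) - s = (m - s) + 1 := by
        rw [Nat.cast_succ, tsub_add_eq_add_tsub hs]
      rw [h1, op_add_apply, hq, ih]
  have hbase : ∀ (n : ℕ) (s u : ℝ≥0) (k : ℕ) (v : X), u ≤ 1 → n ≤ k →
      ‖v‖ ≤ C * r ^ k * ‖d‖ → ‖T.op u v‖ ≤ M * C * (r ^ n * ‖d‖) := by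
    intro n s u k v hu hk hv
    refine ((T.op u).le_of_opNorm_le (hM u (by simpa using hu)) v).trans ?_
    have h1 : r ^ k ≤ r ^ n := pow_le_pow_of_le_one hr0.le hr1.le hk
    calc M * ‖v‖ ≤ M * (C * r ^ k * ‖d‖) := by gcongr
      _ ≤ M * (C * r ^ n * ‖d‖) := by gcongr
      _ = _ := by ring
  refine ⟨p, fun s => T.op (⌈s⌉₊ - s) (q ⌈s⌉₊), by simpa [T.op_zero] using hpq, ?_, ?_, ?_⟩
  · intro a s
    dsimp only
    have h1 : s + a ≤ (⌈s + a⌉₊ : ℝ≥0) := Nat.le_ceil _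
    rw [← hfrom s ⌈s + a⌉₊ (Nat.ceil_mono (by simp)), ← op_add_apply]
    congr 2
    rw [← tsub_tsub, add_tsub_cancel_of_le (le_tsub_of_add_le_left h1)]
  · intro n s hs
    have h1 : (⌊s⌋₊ : ℝ≥0) ≤ s := Nat.floor_le zero_le
    have h2 : T.op s p = T.op (s - ⌊s⌋₊) ((T.op 1 ^ ⌊s⌋₊) p) := by
      rw [← op_natCast, ← op_add_apply, tsub_add_cancel_of_le h1]
    rw [h2]
    refine hbase n s _ ⌊s⌋₊ _ ?_ (Nat.le_floor hs) (hp _)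
    exact tsub_le_iff_left.2 (Nat.lt_floor_add_one s).le
  · intro n s hs
    refine hbase n s _ ⌈s⌉₊ _ ?_ (Nat.cast_le.1 (hs.trans (Nat.le_ceil s))) (hqn _)
    refine tsub_le_iff_left.2 (Nat.ceil_lt_add_one zero_le).le

end C0Semigroup

/-! ### Geometric averages of the jump sizes. -/

section GeometricWeights

/-- The two-sided geometric average of a sequence around the index `i`. -/
noncomputable def geometricAverage (r : ℝ) (a : ℕ → ℝ) (i : ℕ) : ℝ :=
  (∑ k ∈ Finset.range i, r ^ (i - 1 - k) * a k) + ∑' k, r ^ k * a (k + i)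

variable {r δ : ℝ} {a : ℕ → ℝ}

theorem summable_geometric_mul_shift (hr0 : 0 < r) (hr1 : r < 1) (ha0 : ∀ k, 0 ≤ a k)
    (ha : ∀ k, a k ≤ δ) (i : ℕ) : Summable fun k => r ^ k * a (k + i) :=
  Summable.of_nonneg_of_le (fun k => mul_nonneg (by positivity) (ha0 _))
    (fun k => mul_le_mul_of_nonneg_left (ha _) (by positivity))
    ((summable_geometric_of_lt_one hr0.le hr1).mul_right δ)

/-- After reflection the weight `r ^ k` no longer depends on `i`, so dominated convergence applies
as `i → ∞`. -/
theorem sum_range_geometric_mul_eq_tsum (r : ℝ) (a : ℕ → ℝ) (i : ℕ) :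
    ∑ k ∈ Finset.range i, r ^ (i - 1 - k) * a k =
      ∑' k, if k < i then r ^ k * a (i - 1 - k) else 0 := by
  rw [← Finset.sum_range_reflect, tsum_eq_sum (s := Finset.range i)]
  · refine Finset.sum_congr rfl fun k hk => ?_
    have hk' := Finset.mem_range.1 hk
    rw [if_pos hk', show i - 1 - (i - 1 - k) = k by omega]
  · intro k hk
    rw [if_neg (by simpa using hk)]

theorem geometricAverage_le (hr0 : 0 < r) (hr1 : r < 1) (ha0 : ∀ k, 0 ≤ a k)
    (ha : ∀ k, a k ≤ δ) (i : ℕ) : geometricAverage r a i ≤ 2 * δ / (1 - r) := by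
  have hδ : 0 ≤ δ := (ha0 0).trans (ha 0)
  have hg := (summable_geometric_of_lt_one hr0.le hr1).mul_right δ
  have hsum : ∑' k : ℕ, r ^ k * δ = δ / (1 - r) := by
    rw [tsum_mul_right, tsum_geometric_of_lt_one hr0.le hr1]
    ring
  have h1 : ∑ k ∈ Finset.range i, r ^ (i - 1 - k) * a k ≤ δ / (1 - r) := by
    rw [← hsum, ← Finset.sum_range_reflect]
    refine (Finset.sum_le_sum fun k hk => ?_).trans
      (hg.sum_le_tsum (Finset.range i) fun k _ => by positivity)
    have hk' := Finset.mem_range.1 hk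
    rw [show i - 1 - (i - 1 - k) = k by omega]
    exact mul_le_mul_of_nonneg_left (ha _) (by positivity)
  have h2 : ∑' k, r ^ k * a (k + i) ≤ δ / (1 - r) := by
    rw [← hsum]
    exact (summable_geometric_mul_shift hr0 hr1 ha0 ha i).tsum_le_tsum
      (fun k => mul_le_mul_of_nonneg_left (ha _) (by positivity)) hg
  rw [geometricAverage]
  calc _ ≤ δ / (1 - r) + δ / (1 - r) := add_le_add h1 h2
    _ = _ := by ring

theorem tendsto_geometricAverage (hr0 : 0 < r) (hr1 : r < 1) (ha0 : ∀ k, 0 ≤ a k)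
    (ha : ∀ k, a k ≤ δ) (hlim : Tendsto a atTop (𝓝 0)) :
    Tendsto (geometricAverage r a) atTop (𝓝 0) := by
  have hδ : 0 ≤ δ := (ha0 0).trans (ha 0)
  have hg := (summable_geometric_of_lt_one hr0.le hr1).mul_right δ
  have h1 : Tendsto (fun i => ∑ k ∈ Finset.range i, r ^ (i - 1 - k) * a k) atTop (𝓝 0) := by
    simp only [sum_range_geometric_mul_eq_tsum]
    rw [show 𝓝 (0 : ℝ) = 𝓝 (∑' _ : ℕ, (0 : ℝ)) by rw [tsum_zero]]
    refine tendsto_tsum_of_dominated_convergence hg (fun k => ?_)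
      (Eventually.of_forall fun i k => ?_)
    · have h2 : Tendsto (fun i : ℕ => i - 1 - k) atTop atTop :=
        (tendsto_sub_atTop_nat k).comp (tendsto_sub_atTop_nat 1)
      have h3 := (hlim.comp h2).const_mul (r ^ k)
      rw [mul_zero] at h3
      refine h3.congr' ?_
      filter_upwards [eventually_gt_atTop k] with i hi
      rw [if_pos hi, Function.comp_apply]
    · split_ifs
      · rw [Real.norm_of_nonneg (mul_nonneg (by positivity) (ha0 _))]
        exact mul_le_mul_of_nonneg_left (ha _) (by positivity)
      · rw [norm_zero]; positivity
  have h2 : Tendsto (fun i => ∑' k, r ^ k * a (k + i)) atTop (𝓝 0) := by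
    rw [show 𝓝 (0 : ℝ) = 𝓝 (∑' _ : ℕ, (0 : ℝ)) by rw [tsum_zero]]
    refine tendsto_tsum_of_dominated_convergence hg (fun k => ?_)
      (Eventually.of_forall fun i k => ?_)
    · have h2 : Tendsto (fun i : ℕ => k + i) atTop atTop := tendsto_atTop_mono
        (fun i => Nat.le_add_left i k) tendsto_id
      simpa using (hlim.comp h2).const_mul (r ^ k)
    · rw [Real.norm_of_nonneg (mul_nonneg (by positivity) (ha0 _))]
      exact mul_le_mul_of_nonneg_left (ha _) (by positivity)
  have h3 := h1.add h2
  rw [add_zero] at h3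
  exact h3

end GeometricWeights

/-! ### Switching times and construction of the shadowing orbit. -/

namespace Semiflow

theorem switchTime_succ (t : ℕ → ℝ≥0) (i : ℕ) :
    switchTime t (i + 1) = switchTime t i + t i := Finset.sum_range_succ _ _

theorem natCast_le_switchTime_sub {t : ℕ → ℝ≥0} (ht : ∀ i, 1 ≤ t i) (i n : ℕ) :
    (n : ℝ≥0) ≤ switchTime t (i + n) - switchTime t i := by
  refine le_tsub_of_add_le_left ?_
  induction n with
  | zero => simp
  | succ n ih =>
    rw [← add_assoc i, switchTime_succ, Nat.cast_succ, ← add_assoc]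
    exact add_le_add ih (ht _)

/-- Steps of length at least one make the switching times unbounded, so every time lies in one of
the intervals. -/
theorem exists_switchTime_le_lt {t : ℕ → ℝ≥0} (ht : ∀ i, 1 ≤ t i) (s : ℝ≥0) :
    ∃ i, switchTime t i ≤ s ∧ s < switchTime t (i + 1) := by
  have hex : ∃ n, s < switchTime t n := by
    obtain ⟨n, hn⟩ := exists_nat_gt s
    have h := natCast_le_switchTime_sub ht 0 n
    rw [zero_add, show switchTime t 0 = 0 from rfl, tsub_zero] at h
    exact ⟨n, hn.trans_le h⟩
  classical
  obtain ⟨i, hi⟩ : ∃ i, Nat.find hex = i + 1 := by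
    refine Nat.exists_eq_succ_of_ne_zero fun h0 => ?_
    have h := Nat.find_spec hex
    rw [h0] at h
    exact not_lt_zero h
  refine ⟨i, not_lt.1 (Nat.find_min hex (by omega)), ?_⟩
  rw [← hi]
  exact Nat.find_spec hex

theorem norm_unstable_le {X : Type*} [NormedAddCommGroup X] {r C : ℝ} {t : ℕ → ℝ≥0} {a : ℕ → ℝ}
    {q : ℕ → ℝ≥0 → X} (ht : ∀ i, 1 ≤ t i)
    (hqn : ∀ k (n : ℕ) (s : ℝ≥0), n ≤ s → ‖q k s‖ ≤ C * (r ^ n * a k)) {i : ℕ} {u : ℝ≥0}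
    (hu : u ≤ t i) (k : ℕ) :
    ‖q (k + i) (switchTime t (k + i + 1) - switchTime t i - u)‖ ≤ C * (r ^ k * a (k + i)) := by
  refine hqn _ _ _ ((natCast_le_switchTime_sub ht (i + 1) k).trans ?_)
  rw [tsub_tsub, show k + i + 1 = i + 1 + k by omega, switchTime_succ]
  gcongr

theorem summable_unstable {X : Type*} [NormedAddCommGroup X] [CompleteSpace X] {r C δ : ℝ}
    {t : ℕ → ℝ≥0} {a : ℕ → ℝ} {q : ℕ → ℝ≥0 → X} (hr0 : 0 < r) (hr1 : r < 1) (ht : ∀ i, 1 ≤ t i)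
    (ha0 : ∀ k, 0 ≤ a k) (ha : ∀ k, a k ≤ δ)
    (hqn : ∀ k (n : ℕ) (s : ℝ≥0), n ≤ s → ‖q k s‖ ≤ C * (r ^ n * a k)) {i : ℕ} {u : ℝ≥0}
    (hu : u ≤ t i) :
    Summable fun k => q (k + i) (switchTime t (k + i + 1) - switchTime t i - u) :=
  Summable.of_norm_bounded ((summable_geometric_mul_shift hr0 hr1 ha0 ha i).mul_left C)
    (norm_unstable_le ht hqn hu)

end Semiflow

namespace C0Semigroup

open Semiflow

variable {X : Type*} [NormedAddCommGroup X] [NormedSpace ℂ X]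

/-- The difference of a shadowing orbit and a broken orbit at time `switchTime t i + u`, written in
terms of the stable parts `p k` and the unstable backward orbits `q k` of the jumps. -/
noncomputable def shadowingError (T : C0Semigroup X) (t : ℕ → ℝ≥0) (p : ℕ → X)
    (q : ℕ → ℝ≥0 → X) (i : ℕ) (u : ℝ≥0) : X :=
  (∑' k, q (k + i) (switchTime t (k + i + 1) - switchTime t i - u)) -
    ∑ k ∈ Finset.range i, T.op (switchTime t i - switchTime t (k + 1) + u) (p k)

section

variable {T : C0Semigroup X} {r C δ : ℝ} {t : ℕ → ℝ≥0} {a : ℕ → ℝ} {p : ℕ → X}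
  {q : ℕ → ℝ≥0 → X}

theorem norm_shadowingError_le [CompleteSpace X] (hr0 : 0 < r) (hr1 : r < 1)
    (ht : ∀ i, 1 ≤ t i) (ha0 : ∀ k, 0 ≤ a k) (ha : ∀ k, a k ≤ δ)
    (hpn : ∀ k (n : ℕ) (s : ℝ≥0), n ≤ s → ‖T.op s (p k)‖ ≤ C * (r ^ n * a k))
    (hqn : ∀ k (n : ℕ) (s : ℝ≥0), n ≤ s → ‖q k s‖ ≤ C * (r ^ n * a k)) {i : ℕ} {u : ℝ≥0}
    (hu : u ≤ t i) : ‖T.shadowingError t p q i u‖ ≤ C * geometricAverage r a i := by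
  have hs := (summable_geometric_mul_shift hr0 hr1 ha0 ha i).mul_left C
  have h1 : ‖∑' k, q (k + i) (switchTime t (k + i + 1) - switchTime t i - u)‖ ≤
      C * ∑' k, r ^ k * a (k + i) := by
    rw [← tsum_mul_left]
    exact tsum_of_norm_bounded hs.hasSum (norm_unstable_le ht hqn hu)
  have h2 : ‖∑ k ∈ Finset.range i, T.op (switchTime t i - switchTime t (k + 1) + u) (p k)‖ ≤
      C * ∑ k ∈ Finset.range i, r ^ (i - 1 - k) * a k := by
    rw [Finset.mul_sum]
    refine norm_sum_le_of_le _ fun k hk => hpn k _ _ ?_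
    have hk' := Finset.mem_range.1 hk
    -- Jump `k` happens at `switchTime t (k + 1)`, hence the exponent `i - 1 - k`.
    have h3 := natCast_le_switchTime_sub ht (k + 1) (i - 1 - k)
    rw [show k + 1 + (i - 1 - k) = i by omega] at h3
    exact h3.trans le_self_add
  rw [shadowingError, geometricAverage, mul_add, add_comm]
  exact (norm_sub_le _ _).trans (add_le_add h1 h2)

theorem op_shadowingError [CompleteSpace X] (hr0 : 0 < r) (hr1 : r < 1)
    (ht : ∀ i, 1 ≤ t i) (ha0 : ∀ k, 0 ≤ a k) (ha : ∀ k, a k ≤ δ)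
    (hq : ∀ k a s, T.op a (q k (s + a)) = q k s)
    (hqn : ∀ k (n : ℕ) (s : ℝ≥0), n ≤ s → ‖q k s‖ ≤ C * (r ^ n * a k)) {i : ℕ} {u : ℝ≥0}
    (hu : u ≤ t i) : T.op u (T.shadowingError t p q i 0) = T.shadowingError t p q i u := by
  rw [shadowingError, shadowingError, map_sub, map_sum,
    (T.op u).map_tsum (summable_unstable hr0 hr1 ht ha0 ha hqn zero_le)]
  congr 1
  · refine tsum_congr fun k => ?_
    rw [tsub_zero]
    have h1 : u ≤ switchTime t (k + i + 1) - switchTime t i := by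
      refine le_tsub_of_add_le_left ((add_le_add_right hu _).trans ?_)
      rw [← switchTime_succ]
      exact switchTime_mono t (by omega)
    nth_rewrite 1 [← tsub_add_cancel_of_le h1]
    exact hq _ _ _
  · refine Finset.sum_congr rfl fun k _ => ?_
    rw [← op_add_apply, add_zero, add_comm]

/-- At the switch, `q i 0` leaves the series of future jumps and `p i` enters the sum of past ones;
together they make up the jump. -/
theorem shadowingError_succ [CompleteSpace X] (hr0 : 0 < r) (hr1 : r < 1)
    (ht : ∀ i, 1 ≤ t i) (ha0 : ∀ k, 0 ≤ a k) (ha : ∀ k, a k ≤ δ)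
    (hqn : ∀ k (n : ℕ) (s : ℝ≥0), n ≤ s → ‖q k s‖ ≤ C * (r ^ n * a k)) (i : ℕ) :
    T.shadowingError t p q (i + 1) 0 = T.shadowingError t p q i (t i) - (p i + q i 0) := by
  rw [shadowingError, shadowingError, Finset.sum_range_succ,
    (summable_unstable hr0 hr1 ht ha0 ha hqn le_rfl).tsum_eq_zero_add]
  have h1 : T.op (switchTime t (i + 1) - switchTime t (i + 1) + 0) (p i) = p i := by
    rw [tsub_self, add_zero, T.op_zero]
    rfl
  have h2 : q (0 + i) (switchTime t (0 + i + 1) - switchTime t i - t i) = q i 0 := by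
    rw [zero_add, switchTime_succ, tsub_tsub, tsub_self]
  have h3 : ∀ k, q (k + 1 + i) (switchTime t (k + 1 + i + 1) - switchTime t i - t i) =
      q (k + (i + 1)) (switchTime t (k + (i + 1) + 1) - switchTime t (i + 1) - 0) := by
    intro k
    rw [show k + 1 + i = k + (i + 1) by omega, tsub_tsub, tsub_zero, switchTime_succ t i]
  have h4 : ∀ k ∈ Finset.range i,
      T.op (switchTime t (i + 1) - switchTime t (k + 1) + 0) (p k) =
        T.op (switchTime t i - switchTime t (k + 1) + t i) (p k) := by
    intro k hk
    have hk' : switchTime t (k + 1) ≤ switchTime t i :=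
      switchTime_mono t (Finset.mem_range.1 hk)
    rw [add_zero, switchTime_succ t i, tsub_add_eq_add_tsub hk']
  rw [h1, h2, tsum_congr h3, Finset.sum_congr rfl h4]
  abel

end

/-- A semigroup with an exponential dichotomy has the L-shadowing property. -/
theorem HasDichotomy.lShadowing [CompleteSpace X] {T : C0Semigroup X} {r C : ℝ} (hr0 : 0 < r)
    (hr1 : r < 1) (hC : 0 ≤ C) (hT : T.HasDichotomy r C) : T.toSemiflow.LShadowing := by
  intro ε hε
  have h1r : 0 < 1 - r := by linarith
  -- This makes the bound `C * (2 * δ / (1 - r))` equal to `ε * (C / (C + 1)) < ε`. The choice `R =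
  -- 1` separates the switching times by at least one unit.
  refine ⟨ε * (1 - r) / (2 * (C + 1)), 1, by positivity, one_pos, fun x t hxt hlim => ?_⟩
  set δ := ε * (1 - r) / (2 * (C + 1)) with hδ
  have ht : ∀ i, 1 ≤ t i := fun i => by exact_mod_cast (hxt i).2.1
  set a : ℕ → ℝ := fun i => dist (T.toSemiflow.map (t i) (x i)) (x (i + 1)) with ha_def
  have ha0 : ∀ i, 0 ≤ a i := fun i => dist_nonneg
  have ha : ∀ i, a i ≤ δ := fun i => (hxt i).2.2.le
  choose p q hpq hq hpn hqn using fun i => hT (x (i + 1) - T.op (t i) (x i))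
  have hnorm : ∀ i, ‖x (i + 1) - T.op (t i) (x i)‖ = a i := fun i => by
    rw [← dist_eq_norm, dist_comm]
    rfl
  simp only [hnorm] at hpn hqn
  have horbit : ∀ i, T.op (switchTime t i) (x 0 + T.shadowingError t p q 0 0) =
      x i + T.shadowingError t p q i 0 := by
    intro i
    induction i with
    | zero =>
      rw [show switchTime t 0 = 0 from rfl, T.op_zero]
      rfl
    | succ i ih =>
      rw [switchTime_succ, add_comm (switchTime t i), op_add_apply, ih, _root_.map_add,
        op_shadowingError hr0 hr1 ht ha0 ha hq hqn le_rfl,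
        shadowingError_succ hr0 hr1 ht ha0 ha hqn, hpq]
      abel
  have hdist : ∀ (s : ℝ≥0) (i : ℕ), switchTime t i ≤ s → s < switchTime t (i + 1) →
      dist (T.toSemiflow.map s (x 0 + T.shadowingError t p q 0 0))
        (T.toSemiflow.brokenOrbit x t s) ≤ C * geometricAverage r a i := by
    intro s i h1 h2
    have hu : s - switchTime t i ≤ t i := by
      rw [tsub_le_iff_left, ← switchTime_succ]
      exact h2.le
    rw [brokenOrbit_eq _ _ h1 h2]
    change dist (T.op s _) (T.op (s - switchTime t i) (x i)) ≤ _
    nth_rewrite 1 [← tsub_add_cancel_of_le h1]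
    rw [op_add_apply, horbit, _root_.map_add, op_shadowingError hr0 hr1 ht ha0 ha hq hqn hu,
      dist_eq_norm, add_sub_cancel_left]
    exact norm_shadowingError_le hr0 hr1 ht ha0 ha hpn hqn hu
  -- No reparametrization of time is needed. The initial correction is purely unstable, since no
  -- jump precedes time zero.
  refine ⟨x 0 + T.shadowingError t p q 0 0, Homeomorph.refl _, strictMono_id, fun s => ?_, ?_⟩
  · obtain ⟨i, h1, h2⟩ := exists_switchTime_le_lt ht s
    refine (hdist s i h1 h2).trans_lt ?_
    calc C * geometricAverage r a i ≤ C * (2 * δ / (1 - r)) := by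
          gcongr
          exact geometricAverage_le hr0 hr1 ha0 ha i
      _ = ε * (C / (C + 1)) := by
          rw [hδ]
          field_simp
      _ < ε * 1 := by
          gcongr
          rw [div_lt_one (by positivity)]
          linarith
      _ = ε := mul_one ε
  · have hav := (tendsto_geometricAverage hr0 hr1 ha0 ha hlim).const_mul C
    rw [mul_zero] at hav
    rw [Metric.tendsto_atTop]
    intro η hη
    obtain ⟨I, hI⟩ := eventually_atTop.1 (hav.eventually_lt_const hη)
    refine ⟨switchTime t I, fun s hs => ?_⟩
    obtain ⟨i, h1, h2⟩ := exists_switchTime_le_lt ht s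
    have hIi : I ≤ i := by
      by_contra hlt
      exact absurd (hs.trans_lt h2) (not_lt.2 (switchTime_mono t (by omega)))
    rw [Real.dist_0_eq_abs, abs_of_nonneg dist_nonneg]
    exact (hdist s i h1 h2).trans_lt (hI i hIi)

end C0Semigroup

theorem mainTheorem2 {H : Type*} [NormedAddCommGroup H] [InnerProductSpace ℂ H] [CompleteSpace H]
    (A : H →ₗ.[ℂ] H) (hA : IsC0Generator A)
    (hspec : operatorSpectrum A ∩ imaginaryAxis = ∅)
    (hres : BddAbove ((fun z => ‖resolventOp A z‖) '' imaginaryAxis)) :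
    CauchyLShadowing A := by
  obtain ⟨T, rfl⟩ := hA
  obtain ⟨K, hK⟩ := hres
  have hR : ∀ z : ℂ, z.re = 0 → IsResolventAt T.generator z (resolventOp T.generator z) := by
    intro z hz
    have h1 : z ∉ operatorSpectrum T.generator := fun h =>
      (Set.mem_empty_iff_false z).1 (hspec ▸ ⟨h, hz⟩)
    obtain ⟨R, h⟩ := not_not.1 h1
    rwa [resolventOp_eq h]
  have hcircle : Metric.sphere (0 : ℂ) 1 ⊆ resolventSet ℂ (T.op 1) := by
    intro w hw
    have hw1 : ‖w‖ = 1 := by simpa using hw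
    have hw0 : w ≠ 0 := norm_ne_zero_iff.1 (by rw [hw1]; exact one_ne_zero)
    -- Points of the unit circle are exponentials of points of `iℝ`, and translating by `2πin` stays
    -- on `iℝ`.
    have hre : (Complex.log w).re = 0 := by rw [Complex.log_re, hw1, Real.log_one]
    have hren : ∀ n : ℤ, (Complex.log w + 2 * Real.pi * n * Complex.I).re = 0 := fun n => by
      simp [hre]
    rw [← Complex.exp_log hw0]
    exact T.exp_mem_resolventSet hre (fun n => hR _ (hren n)) fun n => hK ⟨_, hren n, rfl⟩
  obtain ⟨r, C, hr0, hr1, hC, hT⟩ := T.exists_hasDichotomy hcircle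
  exact ⟨T, rfl, hT.lShadowing hr0 hr1 hC⟩
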